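/- Let $\mathbb{T}$ be the unit circle with normalized Haar measure. An (always non-degenerate) Orlicz function is a convex, non-decreasing function $\phi:[0,\infty)\to[0,\infty)$ with $\phi(0)=0$, $\phi(t)>0$ for $t>0$ and $\lim_{t\to\infty}\phi(t)=\infty$; $\phi^{-1}$ denotes its inverse function on $[0,\infty)$, and for $x\in\mathbb{C}^{\mathbb{N}}$ put $\|x\|_{\ell_\phi}=\inf\{\rho>0:\sum_n\phi(|x(n)|/\rho)\le 1\}\in[0,\infty]$ (with $\inf\emptyset=\infty$). An N-function is such a $\phi$ with $\lim_{t\to0}\phi(t)/t=0$ and $\lim_{t\to\infty}\phi(t)/t=\infty$; its complementary function is $\phi^*(y)=\sup\{xy-\phi(x):0<x<\infty\}$, $y\ge 0$. A family $\{\phi_w\}_{w\in\mathbb{T}}$ of Orlicz functions is called admissible if 1. for every $t\in[0,\infty)$ the function $w\mapsto\phi_w(t)$ is Borel; 2. there is $t_0>0$ such that for every $t\in(0,t_0)$ the function $w\mapsto\log\phi_w^{-1}(t)$ is integrable on $\mathbb{T}$; 3. there are strictly positive sequences $h,k$ such that for every $x\in\mathbb{C}^{\mathbb{N}}$ and a.e.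 $w\in\mathbb{T}$ we have $\|xh\|_1\le\|x\|_{\ell_{\phi_w}}\le\|xk\|_\infty$. It is called strongly admissible if, furthermore, every $\phi_w$ satisfies the $\Delta_2$-condition at $0$, that is, $\limsup_{t\to0}\phi_w(2t)/\phi_w(t)<\infty$. Lemma. Let $\{\phi_w\}_{w\in\mathbb{T}}$ be a strongly admissible family such that every $\phi_w$ is an N-function. Then $\{\phi_w^*\}_{w\in\mathbb{T}}$ is an admissible family of Orlicz functions. -/

import Mathlib

open MeasureTheory Filter Topology Set
open scoped ENNReal

noncomputable section

/-- The Borel σ-algebra on the unit circle `𝕋 = {w ∈ ℂ : |w| = 1}`. -/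
instance instMeasurableSpaceCircle : MeasurableSpace Circle := borel Circle

instance instBorelSpaceCircle : BorelSpace Circle := ⟨rfl⟩

/-- Normalized Haar measure `λ` on the unit circle (total mass one). -/
def circleHaar : Measure Circle :=
  Measure.haarMeasure (⊤ : TopologicalSpace.PositiveCompacts Circle)

/-- A non-degenerate Orlicz function `φ : [0, ∞) → [0, ∞)`: convex, non-decreasing, `φ 0 = 0`,
`φ t → ∞` as `t → ∞`, and `φ t > 0` for `t > 0`.
The values of `φ : ℝ → ℝ` at negative arguments play no role. -/
structure IsOrlicz (φ : ℝ → ℝ) : Prop where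
  convexOn : ConvexOn ℝ (Ici 0) φ
  monotoneOn : MonotoneOn φ (Ici 0)
  map_zero : φ 0 = 0
  tendsto_atTop : Tendsto φ atTop atTop
  pos : ∀ t : ℝ, 0 < t → 0 < φ t

/-- An N-function: a non-degenerate Orlicz function with `φ t / t → 0` as `t → 0` and
`φ t / t → ∞` as `t → ∞`. -/
structure IsNFunction (φ : ℝ → ℝ) : Prop extends IsOrlicz φ where
  tendsto_div_zero : Tendsto (fun t => φ t / t) (𝓝[>] 0) (𝓝 0)
  tendsto_div_atTop : Tendsto (fun t => φ t / t) atTop atTop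

/-- The `Δ₂`-condition at `0`: `limsup_{t → 0} φ (2 t) / φ t < ∞`, the upper limit being taken in
`[0, ∞]`. -/
def SatisfiesDeltaTwo (φ : ℝ → ℝ) : Prop :=
  limsup (fun t : ℝ => ENNReal.ofReal (φ (2 * t) / φ t)) (𝓝[>] 0) < ⊤

/-- The complementary (Young conjugate) function `φ* y = sup {x y - φ x : 0 < x < ∞}`.
The supremum is finite for every `y ≥ 0` when `φ` is an N-function. -/
def youngConj (φ : ℝ → ℝ) (y : ℝ) : ℝ :=
  sSup ((fun x : ℝ => x * y - φ x) '' Ioi 0)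

/-- The inverse function `φ⁻¹ : [0, ∞) → [0, ∞)` of a non-degenerate Orlicz function (which is a
bijection of `[0, ∞)`). -/
def orliczInv (φ : ℝ → ℝ) : ℝ → ℝ :=
  Function.invFunOn φ (Ici 0)

/-- The Luxemburg norm `‖x‖ = inf {ρ > 0 : ∑ φ (|x n| / ρ) ≤ 1}` of the Orlicz sequence space
`ℓ_φ`, as an element of `[0, ∞]`. It equals `∞` exactly when `x ∉ ℓ_φ`. -/
def orliczNorm (φ : ℝ → ℝ) (x : ℕ → ℂ) : ℝ≥0∞ :=
  sInf {r : ℝ≥0∞ | ∃ ρ : ℝ, 0 < ρ ∧ r = ENNReal.ofReal ρ ∧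
    ∑' n, ENNReal.ofReal (φ (‖x n‖ / ρ)) ≤ 1}

/-- An admissible family of (non-degenerate) Orlicz functions indexed by the unit circle. -/
structure IsAdmissible (φ : Circle → ℝ → ℝ) : Prop where
  isOrlicz : ∀ w, IsOrlicz (φ w)
  /-- For every `t ∈ [0, ∞)` the function `w ↦ φ_w t` is Borel. -/
  borel : ∀ t : ℝ, 0 ≤ t → Measurable (fun w => φ w t)
  /-- There is `t₀ > 0` such that `w ↦ log (φ_w⁻¹ t)` is integrable for every `t ∈ (0, t₀)`. -/
  integrable_log_inv : ∃ t₀ : ℝ, 0 < t₀ ∧ ∀ t ∈ Ioo 0 t₀,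
    Integrable (fun w => Real.log (orliczInv (φ w) t)) circleHaar
  /-- There are strictly positive sequences `h, k` such that for every sequence `x` and almost
  every `w` one has `‖x h‖₁ ≤ ‖x‖_{φ_w} ≤ ‖x k‖_∞`. -/
  norm_bounds : ∃ h k : ℕ → ℝ, (∀ n, 0 < h n) ∧ (∀ n, 0 < k n) ∧
    ∀ x : ℕ → ℂ, ∀ᵐ w ∂circleHaar,
      ∑' n, ‖x n * (h n : ℂ)‖ₑ ≤ orliczNorm (φ w) x ∧
      orliczNorm (φ w) x ≤ ⨆ n, ‖x n * (k n : ℂ)‖ₑ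

/-- A strongly admissible family: an admissible family all of whose members satisfy the
`Δ₂`-condition at `0`. -/
structure IsStronglyAdmissible (φ : Circle → ℝ → ℝ) : Prop extends IsAdmissible φ where
  deltaTwo : ∀ w, SatisfiesDeltaTwo (φ w)

end

/-! Measurability passes to `φ_w*` because, by continuity of `φ_w`, the supremum defining it may be
taken over positive rationals. Integrability of the logarithm passes because the two inverses
satisfy `t ≤ φ⁻¹(t) · (φ*)⁻¹(t) ≤ 2t` (`le_orliczInv_mul`, `orliczInv_mul_le`), so the logarithms of
the two inverses at `t` add up to a bounded function of `w`. The norm bounds pass by duality, which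
swaps the two weights. The upper bound puts `1/k` in the unit ball of `ℓ_φ`, so Hölder
(`tsum_mul_le`) bounds the dual norm below with weight `1/(4k)`. The lower bound puts `h` in the
dual unit ball, so its `φ*`-modular is at most one (`tsum_youngConj_le_one`), and the weight `1/h`
works above. -/

/-! ### Orlicz functions, their inverses and Luxemburg norms -/

namespace IsOrlicz

variable {φ : ℝ → ℝ}

theorem nonneg (h : IsOrlicz φ) {x : ℝ} (hx : 0 ≤ x) : 0 ≤ φ x := by
  rcases hx.eq_or_lt with rfl | hx
  · exact h.map_zero.ge
  · exact (h.pos x hx).le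

theorem map_mul_le (h : IsOrlicz φ) {c x : ℝ} (hc : 0 ≤ c) (hc1 : c ≤ 1) (hx : 0 ≤ x) :
    φ (c * x) ≤ c * φ x := by
  have := h.convexOn.2 (mem_Ici.2 hx) (mem_Ici.2 le_rfl) hc (sub_nonneg.2 hc1)
    (add_sub_cancel c 1)
  simpa [h.map_zero] using this

theorem strictMonoOn (h : IsOrlicz φ) : StrictMonoOn φ (Ici 0) := by
  intro s hs r hr hsr
  have hs : 0 ≤ s := hs
  have hr0 : 0 < r := hs.trans_lt hsr
  have h1 := h.map_mul_le (div_nonneg hs hr0.le) ((div_le_one hr0).2 hsr.le) hr0.le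
  rw [div_mul_cancel₀ _ hr0.ne'] at h1
  exact h1.trans_lt (mul_lt_of_lt_one_left (h.pos r hr0) ((div_lt_one hr0).2 hsr))

theorem continuousOn (h : IsOrlicz φ) : ContinuousOn φ (Ici 0) := by
  intro x hx
  rcases (mem_Ici.1 hx).eq_or_lt with rfl | hx
  -- Convexity gives continuity only in the interior; at the endpoint the chord from `0` to `1`
  -- squeezes `φ` to `0`.
  · have hlim : Tendsto (fun x : ℝ => x * φ 1) (𝓝[Ici 0] 0) (𝓝 0) := by
      have : Tendsto (fun x : ℝ => x * φ 1) (𝓝 0) (𝓝 (0 * φ 1)) := by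
        exact (continuous_id.mul continuous_const).tendsto 0
      rw [zero_mul] at this
      exact this.mono_left nhdsWithin_le_nhds
    rw [ContinuousWithinAt, h.map_zero]
    refine tendsto_of_tendsto_of_tendsto_of_le_of_le' tendsto_const_nhds hlim ?_ ?_
    · filter_upwards [self_mem_nhdsWithin] with x hx using h.nonneg hx
    · filter_upwards [self_mem_nhdsWithin, nhdsWithin_le_nhds (Iio_mem_nhds one_pos)] with x hx hx1
      simpa using h.map_mul_le (mem_Ici.1 hx) (le_of_lt hx1) zero_le_one
  · have := h.convexOn.continuousOn_interior
    rw [interior_Ici] at this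
    exact (this.continuousAt (Ioi_mem_nhds hx)).continuousWithinAt

theorem surjOn (h : IsOrlicz φ) : SurjOn φ (Ici 0) (Ici 0) := by
  intro t ht
  obtain ⟨b, hb, hb0⟩ := ((h.tendsto_atTop.eventually_ge_atTop t).and (eventually_ge_atTop 0)).exists
  obtain ⟨x, hx, hxt⟩ := intermediate_value_Icc hb0
    (h.continuousOn.mono Icc_subset_Ici_self) ⟨h.map_zero.le.trans ht, hb⟩
  exact ⟨x, hx.1, hxt⟩

theorem orliczInv_nonneg (h : IsOrlicz φ) {t : ℝ} (ht : 0 ≤ t) : 0 ≤ orliczInv φ t :=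
  Function.invFunOn_mem (h.surjOn ht)

theorem map_orliczInv (h : IsOrlicz φ) {t : ℝ} (ht : 0 ≤ t) : φ (orliczInv φ t) = t :=
  Function.invFunOn_eq (h.surjOn ht)

theorem orliczInv_pos (h : IsOrlicz φ) {t : ℝ} (ht : 0 < t) : 0 < orliczInv φ t := by
  refine (h.orliczInv_nonneg ht.le).lt_of_ne fun h0 => ?_
  have := h.map_orliczInv ht.le
  rw [← h0, h.map_zero] at this
  exact ht.ne this

theorem orliczInv_le_iff (h : IsOrlicz φ) {t s : ℝ} (ht : 0 ≤ t) (hs : 0 ≤ s) :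
    orliczInv φ t ≤ s ↔ t ≤ φ s := by
  rw [← h.strictMonoOn.le_iff_le (h.orliczInv_nonneg ht) (mem_Ici.2 hs), h.map_orliczInv ht]

/-- Convexity and `φ 0 = 0` make `φ x / x` non-decreasing. -/
theorem mul_le_map_mul (h : IsOrlicz φ) {a x : ℝ} (ha : 0 < a) (hx : a ≤ x) :
    x / a * φ a ≤ φ x := by
  have hx0 := ha.trans_le hx
  have h1 := h.map_mul_le (div_nonneg ha.le hx0.le) ((div_le_one hx0).2 hx) hx0.le
  rw [div_mul_cancel₀ _ hx0.ne'] at h1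
  calc x / a * φ a ≤ x / a * (a / x * φ x) := by gcongr
    _ = φ x := by field_simp

theorem measurable_orliczInv {Ω : Type*} [MeasurableSpace Ω] {ψ : Ω → ℝ → ℝ}
    (h : ∀ w, IsOrlicz (ψ w)) (hm : ∀ t : ℝ, 0 ≤ t → Measurable fun w => ψ w t) {t : ℝ}
    (ht : 0 ≤ t) : Measurable fun w => orliczInv (ψ w) t := by
  refine measurable_of_Iic fun s => ?_
  rcases le_or_gt 0 s with hs | hs
  · have : (fun w => orliczInv (ψ w) t) ⁻¹' Iic s = {w | t ≤ ψ w s} := by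
      ext w
      exact (h w).orliczInv_le_iff ht hs
    rw [this]
    exact measurableSet_le measurable_const (hm s hs)
  · have : (fun w => orliczInv (ψ w) t) ⁻¹' Iic s = ∅ := by
      ext w
      simpa using hs.trans_le ((h w).orliczInv_nonneg ht)
    rw [this]
    exact MeasurableSet.empty

/-- If the modular of `y` is at most `A`, then the Luxemburg norm of `y` is at most `max 1 A`. -/
theorem orliczNorm_le_max (h : IsOrlicz φ) (y : ℕ → ℂ) {A : ℝ}
    (hA : ∑' n, ENNReal.ofReal (φ ‖y n‖) ≤ ENNReal.ofReal A) :
    orliczNorm φ y ≤ ENNReal.ofReal (max 1 A) := by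
  set M := max 1 A
  have hM1 : 1 ≤ M := le_max_left _ _
  have hM : 0 < M := one_pos.trans_le hM1
  refine sInf_le ⟨M, hM, rfl, ?_⟩
  calc ∑' n, ENNReal.ofReal (φ (‖y n‖ / M))
      ≤ ∑' n, ENNReal.ofReal M⁻¹ * ENNReal.ofReal (φ ‖y n‖) := by
        refine ENNReal.tsum_le_tsum fun n => ?_
        rw [← ENNReal.ofReal_mul (inv_nonneg.2 hM.le), div_eq_inv_mul]
        exact ENNReal.ofReal_le_ofReal
          (h.map_mul_le (inv_nonneg.2 hM.le) (inv_le_one_of_one_le₀ hM1) (norm_nonneg _))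
    _ ≤ ENNReal.ofReal M⁻¹ * ENNReal.ofReal M := by
        rw [ENNReal.tsum_mul_left]
        gcongr
        exact hA.trans (ENNReal.ofReal_le_ofReal (le_max_right _ _))
    _ = 1 := by
        rw [← ENNReal.ofReal_mul (inv_nonneg.2 hM.le), inv_mul_cancel₀ hM.ne', ENNReal.ofReal_one]

end IsOrlicz

/-! ### Complementary functions -/

namespace IsNFunction

variable {φ : ℝ → ℝ}

/-- Superlinear growth of `φ` makes `x * y - φ x` nonpositive for large `x`. Boundedness ensures
that the real `sSup` is a true supremum and not the default value `0`. -/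
theorem bddAbove_conj (h : IsNFunction φ) (y : ℝ) :
    BddAbove ((fun x : ℝ => x * y - φ x) '' Ioi 0) := by
  obtain ⟨b, hb⟩ := eventually_atTop.1 (h.tendsto_div_atTop.eventually_ge_atTop y)
  refine ⟨max 0 (b * |y|), ?_⟩
  rintro _ ⟨x, hx, rfl⟩
  have hx : 0 < x := hx
  have hφ := h.toIsOrlicz.nonneg hx.le
  dsimp only
  rcases le_total b x with hbx | hxb
  · have := (le_div_iff₀ hx).1 (hb x hbx)
    exact le_max_of_le_left (by linarith)
  · refine le_max_of_le_right ?_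
    have : x * y ≤ b * |y| :=
      (mul_le_mul_of_nonneg_left (le_abs_self y) hx.le).trans
        (mul_le_mul_of_nonneg_right hxb (abs_nonneg y))
    linarith

theorem young (h : IsNFunction φ) {x : ℝ} (hx : 0 < x) (y : ℝ) :
    x * y ≤ φ x + youngConj φ y := by
  have : x * y - φ x ≤ youngConj φ y := le_csSup (h.bddAbove_conj y) ⟨x, hx, rfl⟩
  linarith

theorem _root_.youngConj_le {φ : ℝ → ℝ} {y c : ℝ} (hc : ∀ x, 0 < x → x * y - φ x ≤ c) :
    youngConj φ y ≤ c :=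
  csSup_le (nonempty_Ioi.image _) (by rintro _ ⟨x, hx, rfl⟩; exact hc x hx)

theorem youngConj_mono (h : IsNFunction φ) : Monotone (youngConj φ) := by
  intro y z hyz
  refine youngConj_le fun x hx => ?_
  have := h.young hx z
  nlinarith

theorem youngConj_pos (h : IsNFunction φ) {y : ℝ} (hy : 0 < y) : 0 < youngConj φ y := by
  obtain ⟨x, hx, hx0⟩ := ((h.tendsto_div_zero.eventually (Iio_mem_nhds hy)).and
    self_mem_nhdsWithin).exists
  have hx0 : 0 < x := hx0
  have h1 := (div_lt_iff₀ hx0).1 (mem_Iio.1 hx)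
  have := h.young hx0 y
  linarith

theorem youngConj_zero (h : IsNFunction φ) : youngConj φ 0 = 0 := by
  apply le_antisymm
  · refine youngConj_le fun x hx => ?_
    have := h.pos x hx
    linarith
  -- The supremum runs over `x > 0` only, so the value `0` is approached as `x → 0` and not
  -- attained.
  · have hlim : Tendsto φ (𝓝[>] 0) (𝓝 0) := by
      have := h.toIsOrlicz.continuousOn 0 self_mem_Ici
      rw [ContinuousWithinAt, h.map_zero] at this
      exact this.mono_left (nhdsWithin_mono _ Ioi_subset_Ici_self)
    have : Tendsto (fun x => - φ x) (𝓝[>] 0) (𝓝 0) := by simpa using hlim.neg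
    refine le_of_tendsto this ?_
    filter_upwards [self_mem_nhdsWithin] with x hx
    have := h.young (mem_Ioi.1 hx) 0
    linarith

theorem isOrlicz_youngConj (h : IsNFunction φ) : IsOrlicz (youngConj φ) where
  convexOn := by
    refine ⟨convex_Ici 0, fun y _ z _ a b ha hb hab => youngConj_le fun x hx => ?_⟩
    have h1 := mul_le_mul_of_nonneg_left (h.young hx y) ha
    have h2 := mul_le_mul_of_nonneg_left (h.young hx z) hb
    have h3 : φ x = a * φ x + b * φ x := by rw [← add_mul, hab, one_mul]
    simp only [smul_eq_mul]
    linarith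
  monotoneOn := h.youngConj_mono.monotoneOn _
  map_zero := h.youngConj_zero
  tendsto_atTop := by
    refine tendsto_atTop_mono (fun y => ?_) (tendsto_atTop_add_const_right _ (- φ 1) tendsto_id)
    have := h.young one_pos y
    simp only [id]
    linarith
  pos := fun _ => h.youngConj_pos

/-- In the definition of the complementary function it suffices to use positive rationals. -/
theorem youngConj_le_of_rat (h : IsNFunction φ) {y c : ℝ}
    (hc : ∀ q : ℚ, 0 < q → (q : ℝ) * y - φ q ≤ c) : youngConj φ y ≤ c := by
  refine youngConj_le fun x hx => ?_
  by_contra! hlt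
  have hcont : ContinuousAt (fun x : ℝ => x * y - φ x) x :=
    (continuousAt_id.mul continuousAt_const).sub
      (h.toIsOrlicz.continuousOn.continuousAt (Ici_mem_nhds hx))
  obtain ⟨q, ⟨hq, hq0⟩⟩ := Rat.denseRange_cast.exists_mem_open isOpen_interior
    ⟨x, mem_interior_iff_mem_nhds.2 ((hcont.eventually (Ioi_mem_nhds hlt)).and (Ioi_mem_nhds hx))⟩
    |>.imp fun q hq => interior_subset hq
  have hq0 : (0 : ℝ) < q := hq0
  exact (hc q (by exact_mod_cast hq0)).not_gt hq

theorem youngConj_le_iff (h : IsNFunction φ) {y c : ℝ} :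
    youngConj φ y ≤ c ↔ ∀ q : ℚ, 0 < q → (q : ℝ) * y - φ q ≤ c := by
  refine ⟨fun hc q hq => ?_, h.youngConj_le_of_rat⟩
  have := h.young (x := q) (by exact_mod_cast hq) y
  linarith

theorem measurable_youngConj {Ω : Type*} [MeasurableSpace Ω] {ψ : Ω → ℝ → ℝ}
    (h : ∀ w, IsNFunction (ψ w)) (hm : ∀ t : ℝ, 0 ≤ t → Measurable fun w => ψ w t) (y : ℝ) :
    Measurable fun w => youngConj (ψ w) y := by
  refine measurable_of_Iic fun c => ?_
  have : (fun w => youngConj (ψ w) y) ⁻¹' Iic c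
      = ⋂ q : ℚ, ⋂ _ : 0 < q, {w | (q : ℝ) * y - ψ w q ≤ c} := by
    ext w
    simp [(h w).youngConj_le_iff]
  rw [this]
  refine MeasurableSet.iInter fun q => MeasurableSet.iInter fun hq => ?_
  exact measurableSet_le (measurable_const.sub (hm q (by exact_mod_cast hq.le))) measurable_const

/-- Young's inequality at the two inverses, where both functions take the value `t`. -/
theorem orliczInv_mul_le (h : IsNFunction φ) {t : ℝ} (ht : 0 < t) :
    orliczInv φ t * orliczInv (youngConj φ) t ≤ 2 * t := by
  have := h.young (h.toIsOrlicz.orliczInv_pos ht) (orliczInv (youngConj φ) t)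
  rw [h.toIsOrlicz.map_orliczInv ht.le, h.isOrlicz_youngConj.map_orliczInv ht.le] at this
  linarith

/-- With `a = φ⁻¹(t)`, it amounts to `φ*(t / a) ≤ t`. The line of slope `t / a` through the origin
is at most `t` up to `a` and lies below `φ` beyond `a`. -/
theorem le_orliczInv_mul (h : IsNFunction φ) {t : ℝ} (ht : 0 < t) :
    t ≤ orliczInv φ t * orliczInv (youngConj φ) t := by
  have ha := h.toIsOrlicz.orliczInv_pos ht
  have hat := h.toIsOrlicz.map_orliczInv ht.le
  set a := orliczInv φ t
  have hO := h.isOrlicz_youngConj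
  rw [← div_le_iff₀' ha, ← hO.strictMonoOn.le_iff_le (div_nonneg ht.le ha.le)
    (hO.orliczInv_nonneg ht.le), hO.map_orliczInv ht.le]
  refine youngConj_le fun x hx => ?_
  have hφ := h.pos x hx
  rcases le_total x a with hxa | hax
  · have : x * (t / a) ≤ a * (t / a) := by gcongr
    rw [mul_div_cancel₀ _ ha.ne'] at this
    linarith
  · have := h.toIsOrlicz.mul_le_map_mul ha hax
    rw [hat] at this
    have e : x * (t / a) = x / a * t := by ring
    linarith

theorem log_orliczInv_youngConj_mem (h : IsNFunction φ) {t : ℝ} (ht : 0 < t) :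
    Real.log (orliczInv (youngConj φ) t) ∈
      Icc (Real.log t - Real.log (orliczInv φ t))
        (Real.log (2 * t) - Real.log (orliczInv φ t)) := by
  have ha := h.toIsOrlicz.orliczInv_pos ht
  have hb := h.isOrlicz_youngConj.orliczInv_pos ht
  have h1 := Real.log_le_log ht (h.le_orliczInv_mul ht)
  have h2 := Real.log_le_log (mul_pos ha hb) (h.orliczInv_mul_le ht)
  rw [Real.log_mul ha.ne' hb.ne'] at h1 h2
  constructor <;> linarith

/-! ### Duality of the norms -/

/-- Hölder's inequality in Orlicz sequence spaces, for `y` in the closed unit ball of `ℓ_φ`. -/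
theorem tsum_mul_le (h : IsNFunction φ) {y : ℕ → ℝ} (hy0 : ∀ n, 0 < y n)
    (hy : orliczNorm φ (fun n => (y n : ℂ)) ≤ 1) (x : ℕ → ℂ) :
    ∑' n, ‖x n * ((y n / 4 : ℝ) : ℂ)‖ₑ ≤ orliczNorm (youngConj φ) x := by
  -- Any admissible radius `σ < 2` avoids asking whether the infimum is attained. This costs one
  -- factor 2 of the constant 4; the other comes from adding two modulars, each at most one.
  obtain ⟨_, ⟨σ, hσ, rfl, hσ1⟩, hσ2⟩ := sInf_lt_iff.1
    (hy.trans_lt (show (1 : ℝ≥0∞) < ENNReal.ofReal 2 by norm_num))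
  have hσ2 : σ < 2 := (ENNReal.ofReal_lt_ofReal_iff two_pos).1 hσ2
  refine le_sInf ?_
  rintro _ ⟨ρ, hρ, rfl, hρ1⟩
  have key : ∀ n, ‖x n * ((y n / 4 : ℝ) : ℂ)‖ₑ ≤ ENNReal.ofReal (ρ / 2) *
      (ENNReal.ofReal (φ (‖(y n : ℂ)‖ / σ)) + ENNReal.ofReal (youngConj φ (‖x n‖ / ρ))) := by
    intro n
    have hyn : ‖(y n : ℂ)‖ = y n := by simp [abs_of_pos (hy0 n)]
    have hpos : 0 < y n / σ := div_pos (hy0 n) hσ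
    rw [hyn, ← ENNReal.ofReal_add (h.toIsOrlicz.nonneg hpos.le)
      (h.isOrlicz_youngConj.nonneg (by positivity)), ← ENNReal.ofReal_mul (by positivity),
      ← ofReal_norm]
    refine ENNReal.ofReal_le_ofReal ?_
    have hn : ‖x n * ((y n / 4 : ℝ) : ℂ)‖ = ‖x n‖ * (y n / 4) := by
      rw [norm_mul, Complex.norm_real, Real.norm_of_nonneg (by linarith [hy0 n])]
    rw [hn]
    calc ‖x n‖ * (y n / 4) = σ / 2 * (ρ / 2 * (y n / σ * (‖x n‖ / ρ))) := by
          field_simp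
          ring
      _ ≤ 1 * (ρ / 2 * (y n / σ * (‖x n‖ / ρ))) := by
          gcongr
          linarith
      _ ≤ ρ / 2 * (φ (y n / σ) + youngConj φ (‖x n‖ / ρ)) := by
          rw [one_mul]
          gcongr
          exact h.young hpos _
  calc ∑' n, ‖x n * ((y n / 4 : ℝ) : ℂ)‖ₑ
      ≤ ∑' n, ENNReal.ofReal (ρ / 2) *
      (ENNReal.ofReal (φ (‖(y n : ℂ)‖ / σ)) + ENNReal.ofReal (youngConj φ (‖x n‖ / ρ))) :=
        ENNReal.tsum_le_tsum key
    _ ≤ ENNReal.ofReal (ρ / 2) * (1 + 1) := by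
        rw [ENNReal.tsum_mul_left, ENNReal.tsum_add]
        gcongr
    _ = ENNReal.ofReal ρ := by
        rw [one_add_one_eq_two, ← ENNReal.ofReal_ofNat 2, ← ENNReal.ofReal_mul (by positivity)]
        congr 1
        ring

/-- If `h` is in the unit ball of the dual of `ℓ_φ` (tested on finitely supported rational
sequences), then its modular with respect to the complementary function is at most one. -/
theorem tsum_youngConj_le_one (hN : IsNFunction φ) {h : ℕ → ℝ} (h0 : ∀ n, 0 < h n)
    (hd : ∀ q : ℕ →₀ ℚ, ∑' n, ‖((q n : ℂ)) * (h n : ℂ)‖ₑ ≤ orliczNorm φ fun n => (q n : ℂ)) :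
    ∑' n, ENNReal.ofReal (youngConj φ (h n)) ≤ 1 := by
  have hO := hN.toIsOrlicz
  -- Testing `h` on `q` cut off to `s` gives `∑ q h ≤ max 1 (∑ φ q) ≤ 1 + ∑ φ q`. Near-optimal `q`
  -- in each coordinate then turn the left side into the modular of `h`.
  have key : ∀ (s : Finset ℕ) (q : ℕ → ℚ), (∀ n, 0 < q n) →
      ∑ n ∈ s, ((q n : ℝ) * h n - φ (q n)) ≤ 1 := by
    intro s q hq
    have hq' : ∀ n, (0 : ℝ) < q n := fun n => by exact_mod_cast hq n
    let p : ℕ →₀ ℚ := Finsupp.onFinset s (fun n => if n ∈ s then q n else 0) (by simp +contextual)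
    have hp1 : ∀ n ∈ s, p n = q n := fun n hn => by simp [p, hn]
    have hp0 : ∀ n ∉ s, p n = 0 := fun n hn => by simp [p, hn]
    have hA : ∑' n, ENNReal.ofReal (φ ‖(p n : ℂ)‖)
        ≤ ENNReal.ofReal (∑ n ∈ s, φ (q n)) := by
      rw [tsum_eq_sum (s := s) (fun n hn => by simp [hp0 n hn, hO.map_zero]),
        ENNReal.ofReal_sum_of_nonneg fun n _ => hO.nonneg (hq' n).le]
      refine Finset.sum_le_sum fun n hn => ?_
      rw [hp1 n hn, Complex.norm_ratCast, abs_of_pos (hq' n)]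
    have hB : ∑' n, ‖(p n : ℂ) * (h n : ℂ)‖ₑ = ENNReal.ofReal (∑ n ∈ s, (q n : ℝ) * h n) := by
      rw [tsum_eq_sum (s := s) (fun n hn => by simp [hp0 n hn]),
        ENNReal.ofReal_sum_of_nonneg fun n _ => (mul_pos (hq' n) (h0 n)).le]
      refine Finset.sum_congr rfl fun n hn => ?_
      rw [hp1 n hn, ← ofReal_norm, norm_mul, Complex.norm_ratCast, Complex.norm_real,
        abs_of_pos (hq' n), Real.norm_of_nonneg (h0 n).le]
    have hC := (hd p).trans (hO.orliczNorm_le_max (fun n => (p n : ℂ)) hA)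
    rw [hB, ENNReal.ofReal_le_ofReal_iff (zero_le_one.trans (le_max_left _ _))] at hC
    have hs : 0 ≤ ∑ n ∈ s, φ (q n) := Finset.sum_nonneg fun n _ => hO.nonneg (hq' n).le
    rw [Finset.sum_sub_distrib]
    rcases max_cases 1 (∑ n ∈ s, φ (q n)) with ⟨h1, -⟩ | ⟨h1, -⟩ <;> linarith
  rw [ENNReal.tsum_eq_iSup_sum]
  refine iSup_le fun s => ?_
  rw [← ENNReal.ofReal_sum_of_nonneg
    fun n _ => hN.isOrlicz_youngConj.nonneg (h0 n).le, ENNReal.ofReal_le_one]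
  refine le_of_forall_pos_le_add fun ε hε => ?_
  -- The error `ε` is shared among the coordinates of `s`; the `+ 1` covers empty `s`.
  have hδ : 0 < ε / (s.card + 1) := by positivity
  have hex : ∀ n, ∃ q : ℚ, 0 < q ∧
      youngConj φ (h n) - ε / (s.card + 1) < (q : ℝ) * h n - φ q := by
    intro n
    by_contra! hcon
    have := hN.youngConj_le_of_rat hcon
    linarith
  choose q hq hqlt using hex
  calc ∑ n ∈ s, youngConj φ (h n)
      ≤ ∑ n ∈ s, (((q n : ℝ) * h n - φ (q n)) + ε / (s.card + 1)) :=
        Finset.sum_le_sum fun n _ => by linarith [hqlt n]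
    _ = ∑ n ∈ s, ((q n : ℝ) * h n - φ (q n)) + s.card * (ε / (s.card + 1)) := by
        rw [Finset.sum_add_distrib, Finset.sum_const, nsmul_eq_mul]
    _ ≤ 1 + ε := by
        refine add_le_add (key s q hq) ?_
        rw [← mul_div_assoc, div_le_iff₀ (by positivity)]
        nlinarith

end IsNFunction

/-- If `h` has modular at most one, then the Luxemburg norm is dominated by the supremum norm
with weight `1 / h`. -/
theorem IsOrlicz.orliczNorm_le_iSup {ψ : ℝ → ℝ} (hψ : IsOrlicz ψ) {h : ℕ → ℝ}
    (h0 : ∀ n, 0 < h n) (h1 : ∑' n, ENNReal.ofReal (ψ (h n)) ≤ 1) (x : ℕ → ℂ) :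
    orliczNorm ψ x ≤ ⨆ n, ‖x n * (((h n)⁻¹ : ℝ) : ℂ)‖ₑ := by
  -- A radius strictly above the supremum is positive, even when `x = 0`, and satisfies `‖x n‖ / r ≤
  -- h n` for every `n`.
  refine le_of_forall_gt_imp_ge_of_dense fun r hr => ?_
  rcases eq_or_ne r ⊤ with rfl | hrt
  · exact le_top
  have hρ : 0 < r.toReal := ENNReal.toReal_pos (bot_le.trans_lt hr).ne' hrt
  refine sInf_le ⟨r.toReal, hρ, (ENNReal.ofReal_toReal hrt).symm, le_trans ?_ h1⟩
  refine ENNReal.tsum_le_tsum fun n => ENNReal.ofReal_le_ofReal ?_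
  refine hψ.monotoneOn (mem_Ici.2 (by positivity)) (mem_Ici.2 (h0 n).le) ?_
  have hn := (le_iSup (fun n => ‖x n * (((h n)⁻¹ : ℝ) : ℂ)‖ₑ) n).trans hr.le
  rw [← ofReal_norm, norm_mul, Complex.norm_real,
    Real.norm_of_nonneg (inv_nonneg.2 (h0 n).le), ENNReal.ofReal_le_iff_le_toReal hrt,
    ← div_eq_mul_inv, div_le_iff₀ (h0 n)] at hn
  rwa [div_le_iff₀' hρ]

instance : IsFiniteMeasure circleHaar := by
  unfold circleHaar
  infer_instance

theorem lemma4p6 (φ : Circle → ℝ → ℝ) (hN : ∀ w, IsNFunction (φ w))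
    (hφ : IsStronglyAdmissible φ) :
    IsAdmissible (fun w => youngConj (φ w)) := by
  have hO : ∀ w, IsOrlicz (youngConj (φ w)) := fun w => (hN w).isOrlicz_youngConj
  have hB : ∀ t : ℝ, 0 ≤ t → Measurable fun w => youngConj (φ w) t :=
    fun t _ => IsNFunction.measurable_youngConj hN hφ.borel t
  refine ⟨hO, hB, ?_, ?_⟩
  · obtain ⟨t₀, ht₀, hint⟩ := hφ.integrable_log_inv
    refine ⟨t₀, ht₀, fun t ht => ?_⟩
    have hm := (IsOrlicz.measurable_orliczInv hO hB ht.1.le).log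
    exact integrable_of_le_of_le hm.aestronglyMeasurable
      (ae_of_all _ fun w => ((hN w).log_orliczInv_youngConj_mem ht.1).1)
      (ae_of_all _ fun w => ((hN w).log_orliczInv_youngConj_mem ht.1).2)
      ((integrable_const _).sub (hint t ht)) ((integrable_const _).sub (hint t ht))
  · obtain ⟨h, k, h0, k0, hb⟩ := hφ.norm_bounds
    refine ⟨fun n => (k n)⁻¹ / 4, fun n => (h n)⁻¹,
      fun n => div_pos (inv_pos.2 (k0 n)) (by norm_num), fun n => inv_pos.2 (h0 n), fun x => ?_⟩
    -- The exceptional null set depends on the test sequence; finitely supported rational sequences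
    -- are countable, so one null set serves them all.
    have hq : ∀ᵐ w ∂circleHaar, ∀ q : ℕ →₀ ℚ,
        ∑' n, ‖((q n : ℂ)) * (h n : ℂ)‖ₑ ≤ orliczNorm (φ w) fun n => (q n : ℂ) :=
      ae_all_iff.2 fun q => (hb fun n => (q n : ℂ)).mono fun w hw => hw.1
    filter_upwards [hq, hb fun n => (((k n)⁻¹ : ℝ) : ℂ)] with w hw hw'
    refine ⟨(hN w).tsum_mul_le (fun n => inv_pos.2 (k0 n)) (hw'.2.trans ?_) x,
      (hO w).orliczNorm_le_iSup h0 ((hN w).tsum_youngConj_le_one h0 hw) x⟩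
    -- The sequence `1/k` has weighted supremum norm one, hence lies in the unit ball of `ℓ_φ`.
    refine iSup_le fun n => ?_
    rw [← Complex.ofReal_mul, inv_mul_cancel₀ (k0 n).ne']
    simp
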